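/- **Conventions.** Identify $\mathbb{R}/\mathbb{Z}$ with $[0,1)$. For $x\in[0,1)$ and $i\ge 1$ let $x_i\in\{0,1\}$ be the $i$-th binary digit of $x$, so that $x=\sum_{i\ge1}x_i2^{-i}$, where for a dyadic rational the expansion with finitely many digits $1$ is used. For $x,y\in[0,1)$, call $y$ a *subsequence of $x$ in terms of binary expansion* if there is an integer $N>0$ such that $y_j=0$ for all $1\le j\le N$ and, for all $i\ge1$, $y_{i+N}=1$ implies $x_i=1$. A set $E\subset\mathbb{R}/\mathbb{Z}$ is a *(binary) Erdős semigroup* if $E=\bigcup_{i\in\mathbb{N}}F_i$ for some sets $F_i\subset\mathbb{R}/\mathbb{Z}$ such that 1. each $F_i$ is closed in $\mathbb{R}/\mathbb{Z}$ and $\times2 \bmod 1$ invariant, i.e. $t\in F_i$ implies $2t\in F_i$; 2. there is a function $W:\mathbb{N}^2\to\mathbb{N}$ such that $F_i+F_j\subset F_{W(i,j)}$ for all $i,j$ (addition in $\mathbb{R}/\mathbb{Z}$); 3. for every $i$, if $x\in F_i$ and $y$ is a subsequence of $x$ in terms of binary expansion, then $y\in F_i$. **Theorem.** Let $E\subset\mathbb{R}/\mathbb{Z}$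 be an Erdős semigroup, viewed as a subset of $[0,1)$, with full Hausdorff dimension, $\dim_{\mathrm H}E=1$. Then there is $b>0$ such that $E$ is a basis of order $2$ for $(0,b]$, that is, there exists $x\in E$ with $$(0,b]\subset E+xE=\{e+xf: e,f\in E\},$$ where addition and multiplication are those of $\mathbb{R}$. -/

import Mathlib

open scoped Pointwise

/-- A subset of `ℝ/ℤ` viewed as a subset of `[0,1)`, every class being identified with its unique
representative in `[0,1)`. -/
def circleToUnit (E : Set UnitAddCircle) : Set ℝ :=
  {x : ℝ | x ∈ Set.Ico (0 : ℝ) 1 ∧ (x : UnitAddCircle) ∈ E}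

/-- `y` is a subsequence of `x` in terms of binary expansions, for `x, y ∈ [0,1)`: for some `N > 0`,
the first `N` binary digits of `y` vanish, and whenever the digit of `y` at position `i + N` is `1`,
the digit of `x` at position `i` is `1`.

`Real.digits x 2 i` is the binary digit of `x` of weight `2 ^ (-(i + 1))`, that is
`⌊x * 2 ^ (i + 1)⌋` modulo `2`; for dyadic rationals this is the expansion with finitely many
digits `1`. -/
def IsBinarySubsequence (y x : ℝ) : Prop :=
  ∃ N : ℕ, 0 < N ∧ (∀ j < N, Real.digits y 2 j = 0) ∧
    ∀ i : ℕ, Real.digits y 2 (i + N) = 1 → Real.digits x 2 i = 1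

/-- Binary Erdős semigroups in `ℝ/ℤ`. -/
def IsErdosSemigroup (E : Set UnitAddCircle) : Prop :=
  ∃ F : ℕ → Set UnitAddCircle,
    E = ⋃ i, F i ∧
    (∀ i, IsClosed (F i)) ∧
    (∀ i, ∀ t ∈ F i, 2 • t ∈ F i) ∧
    (∃ W : ℕ → ℕ → ℕ, ∀ i j, F i + F j ⊆ F (W i j)) ∧
    ∀ i, ∀ x ∈ circleToUnit (F i), ∀ y ∈ Set.Ico (0 : ℝ) 1,
      IsBinarySubsequence y x → y ∈ circleToUnit (F i)

/-- `E` is a basis of order `2` for `I`: `I ⊆ E + xE` for some `x ∈ E`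
(addition and multiplication of real numbers). -/
def IsBasisOfOrderTwo (E I : Set ℝ) : Prop :=
  ∃ x ∈ E, I ⊆ E + x • E

open MeasureTheory Filter Topology Set
open scoped ENNReal NNReal

/-! Let `K ⊆ E` be compact of dimension greater than `2 / 3`. Put Frostman weights at scale `2⁻ⁿ` on
three copies of `K`. A large sieve bound shows that for an average `x ∈ K` the points `e + x f` with
`e, f ∈ K` have few collisions at this scale, so `K + xK` has a neighbourhood of radius `2⁻ⁿ` whose
measure is bounded below independently of `n`. By compactness `K + xK` itself has positive measure
for some `x ∈ K`, and by Steinhaus `(K + xK) + (K + xK)` contains an interval. The multipliers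
`m / 2ᴺ ≤ 1 / 2` carry `E + E` into `E`, and they move this interval over some `(0, b]`. -/

section FejerKernel

/-- The Fejér kernel on the line: the cosine transform of the tent function `r ↦ 1 - r / L` on
`[0, L]` (see `integral_tent_mul_cos`), written in closed form. -/
noncomputable def fejerKernel (L z : ℝ) : ℝ := L / 2 * Real.sinc (L * z / 2) ^ 2

theorem integral_tent_mul_cos {L : ℝ} (hL : L ≠ 0) (z : ℝ) :
    ∫ r in (0 : ℝ)..L, (1 - r / L) * Real.cos (r * z) = fejerKernel L z := by
  rcases eq_or_ne z 0 with rfl | hz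
  · simp only [fejerKernel, mul_zero, Real.cos_zero, mul_one, zero_div, Real.sinc_zero, one_pow]
    rw [intervalIntegral.integral_sub (by simp)
      (Continuous.intervalIntegrable (by fun_prop) _ _), intervalIntegral.integral_div]
    simp only [intervalIntegral.integral_const, integral_id, smul_eq_mul]
    field_simp
    ring
  · have antideriv (r : ℝ) : HasDerivAt
        (fun r => (1 - r / L) * (Real.sin (r * z) / z) - Real.cos (r * z) / (L * z ^ 2))
        ((1 - r / L) * Real.cos (r * z)) r := by
      have hlin : HasDerivAt (fun r : ℝ => r * z) z r := by
        simpa using (hasDerivAt_id r).mul_const z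
      have htent : HasDerivAt (fun r : ℝ => 1 - r / L) (-(1 / L)) r := by
        simpa using ((hasDerivAt_id r).div_const L).const_sub 1
      refine ((htent.mul (hlin.sin.div_const z)).sub
        (hlin.cos.div_const (L * z ^ 2))).congr_deriv ?_
      field_simp
      ring
    have hcos : Real.cos (L * z) = 1 - 2 * Real.sin (L * z / 2) ^ 2 := by
      have h := Real.sin_sq_eq_half_sub (L * z / 2)
      rw [mul_div_cancel₀ _ two_ne_zero] at h
      linarith
    rw [intervalIntegral.integral_eq_sub_of_hasDerivAt (fun r _ => antideriv r)
      (Continuous.intervalIntegrable (by fun_prop) _ _), fejerKernel,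
      Real.sinc_of_ne_zero (by positivity), hcos]
    simp only [zero_div, sub_zero, zero_mul, Real.sin_zero, mul_zero, Real.cos_zero, zero_sub,
      sub_neg_eq_add]
    field_simp
    ring

theorem fejerKernel_nonneg {L : ℝ} (hL : 0 ≤ L) (z : ℝ) : 0 ≤ fejerKernel L z := by
  unfold fejerKernel
  positivity

theorem mul_sinc (x : ℝ) : x * Real.sinc x = Real.sin x := by
  rcases eq_or_ne x 0 with rfl | hx
  · simp
  · rw [Real.sinc_of_ne_zero hx, mul_div_cancel₀ _ hx]

theorem half_le_sinc_sq {x : ℝ} (hx : |x| ≤ 1) : 1 / 2 ≤ Real.sinc x ^ 2 := by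
  rcases eq_or_ne x 0 with rfl | hx0
  · norm_num
  have hx1 : x ^ 2 ≤ 1 := (sq_le_one_iff_abs_le_one x).2 hx
  have hcos : Real.cos x ≤ 1 - 43 / 96 * x ^ 2 := by
    have := (abs_le.1 (Real.cos_bound hx)).2
    rw [Even.pow_abs (by decide)] at this
    nlinarith
  have hcos0 : 0 ≤ Real.cos x := Real.cos_nonneg_of_neg_pi_div_two_le_of_le
    (by linarith [(abs_le.1 hx).1, Real.pi_gt_three])
    (by linarith [(abs_le.1 hx).2, Real.pi_gt_three])
  rw [Real.sinc_of_ne_zero hx0, div_pow, le_div_iff₀ (by positivity), Real.sin_sq]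
  nlinarith [pow_le_pow_left₀ hcos0 hcos 2]

theorem fejerKernel_le {L : ℝ} (hL : 0 ≤ L) (z : ℝ) :
    fejerKernel L z ≤ 4 * L / (1 + (L * z) ^ 2) := by
  have hsinc : Real.sinc (L * z / 2) ^ 2 ≤ 1 :=
    (sq_le_one_iff_abs_le_one _).2 (Real.abs_sinc_le_one _)
  have hsin : (L * z / 2 * Real.sinc (L * z / 2)) ^ 2 ≤ 1 := by
    rw [mul_sinc]
    exact Real.sin_sq_le_one _
  rw [fejerKernel, le_div_iff₀ (by positivity)]
  nlinarith

theorem le_fejerKernel {L z : ℝ} (hL : 0 ≤ L) (hz : |L * z| ≤ 1) : L / 4 ≤ fejerKernel L z := by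
  have hz2 : |L * z / 2| ≤ 1 := by
    rw [abs_div, abs_two]
    linarith
  rw [fejerKernel]
  nlinarith [half_le_sinc_sq hz2]

end FejerKernel

section ExponentialSums

variable {ι κ : Type*} [Fintype ι] [Fintype κ]

/-- The Fourier transform of the discrete signed measure with masses `a i` at the points `y i`. -/
noncomputable def expSum (a y : ι → ℝ) (r : ℝ) : ℂ :=
  ∑ i, (a i : ℂ) * Complex.exp ((r * y i : ℝ) * Complex.I)

@[fun_prop]
theorem continuous_expSum (a y : ι → ℝ) : Continuous (expSum a y) := by
  unfold expSum
  fun_prop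

theorem hasDerivAt_expSum (a y : ι → ℝ) (r : ℝ) :
    HasDerivAt (expSum a y) (Complex.I * expSum (a * y) y r) r := by
  have hterm (i : ι) : HasDerivAt
      (fun r : ℝ => (a i : ℂ) * Complex.exp ((r * y i : ℝ) * Complex.I))
      ((a i : ℂ) * (Complex.exp ((r * y i : ℝ) * Complex.I) * ((y i : ℝ) * Complex.I))) r := by
    have hlin : HasDerivAt (fun r : ℝ => r * y i) (y i) r := by
      simpa using (hasDerivAt_id r).mul_const (y i)
    exact ((hlin.ofReal_comp.mul_const Complex.I).cexp).const_mul _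
  refine (HasDerivAt.fun_sum fun i _ => hterm i).congr_deriv ?_
  rw [expSum, Finset.mul_sum]
  refine Finset.sum_congr rfl fun i _ => ?_
  push_cast [Pi.mul_apply]
  ring

theorem norm_sq_expSum (a y : ι → ℝ) (r : ℝ) :
    ‖expSum a y r‖ ^ 2 = ∑ i, ∑ k, a i * a k * Real.cos (r * (y i - y k)) := by
  have hre : (expSum a y r).re = ∑ i, a i * Real.cos (r * y i) := by
    simp only [expSum, Complex.re_sum, Complex.re_ofReal_mul, Complex.exp_ofReal_mul_I_re]
  have him : (expSum a y r).im = ∑ i, a i * Real.sin (r * y i) := by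
    simp only [expSum, Complex.im_sum, Complex.im_ofReal_mul, Complex.exp_ofReal_mul_I_im]
  simp only [Complex.sq_norm, Complex.normSq_apply, hre, him, Finset.sum_mul_sum,
    ← Finset.sum_add_distrib, mul_sub, Real.cos_sub]
  refine Finset.sum_congr rfl fun i _ => Finset.sum_congr rfl fun k _ => ?_
  ring

theorem norm_expSum_le {w y : ι → ℝ} (hw : ∀ i, 0 ≤ w i) (r : ℝ) : ‖expSum w y r‖ ≤ ∑ i, w i := by
  refine (norm_sum_le _ _).trans (Finset.sum_le_sum fun i _ => ?_)
  rw [norm_mul, Complex.norm_exp_ofReal_mul_I, mul_one, Complex.norm_real, Real.norm_eq_abs,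
    abs_of_nonneg (hw i)]

theorem expSum_prod (a u : ι → ℝ) (b v : κ → ℝ) (x r : ℝ) :
    expSum (fun p : ι × κ => a p.1 * b p.2) (fun p => u p.1 + x * v p.2) r =
      expSum a u r * expSum b v (x * r) := by
  simp only [expSum, Fintype.sum_prod_type, Finset.sum_mul_sum]
  refine Finset.sum_congr rfl fun i _ => Finset.sum_congr rfl fun k _ => ?_
  rw [mul_mul_mul_comm, ← Complex.exp_add]
  push_cast
  congr 2
  ring

theorem integral_tent_mul_norm_sq_expSum (a y : ι → ℝ) {L : ℝ} (hL : L ≠ 0) :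
    ∫ r in (0 : ℝ)..L, (1 - r / L) * ‖expSum a y r‖ ^ 2 =
      ∑ i, ∑ k, a i * a k * fejerKernel L (y i - y k) := by
  simp only [norm_sq_expSum, Finset.mul_sum, ← integral_tent_mul_cos hL,
    ← intervalIntegral.integral_const_mul]
  rw [intervalIntegral.integral_finsetSum fun i _ =>
    Continuous.intervalIntegrable (by fun_prop) _ _]
  refine Finset.sum_congr rfl fun i _ => ?_
  rw [intervalIntegral.integral_finsetSum fun k _ =>
    Continuous.intervalIntegrable (by fun_prop) _ _]
  refine Finset.sum_congr rfl fun k _ => intervalIntegral.integral_congr fun r _ => ?_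
  ring

end ExponentialSums

section Concentration

variable {ι : Type*} [Fintype ι] {w y : ι → ℝ}

/-- The Lévy concentration function of the discrete measure with masses `w i ≥ 0` at the points
`y i`: the largest mass of a half-open interval of length `δ`. -/
noncomputable def concentration (w y : ι → ℝ) (δ : ℝ) : ℝ :=
  ⨆ a, ∑ i with y i ∈ Ico a (a + δ), w i

theorem concentration_le {δ B : ℝ} (hB : ∀ a, ∑ i with y i ∈ Ico a (a + δ), w i ≤ B) :
    concentration w y δ ≤ B :=
  ciSup_le hB

theorem sum_le_concentration (hw : ∀ i, 0 ≤ w i) {s : Finset ι} {a δ : ℝ}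
    (hs : ∀ i ∈ s, y i ∈ Ico a (a + δ)) : ∑ i ∈ s, w i ≤ concentration w y δ := by
  have hbdd : BddAbove (range fun a => ∑ i with y i ∈ Ico a (a + δ), w i) := by
    refine ⟨∑ i, w i, ?_⟩
    rintro _ ⟨a, rfl⟩
    exact Finset.sum_le_univ_sum_of_nonneg hw
  refine le_trans ?_ (le_ciSup hbdd a)
  exact Finset.sum_le_sum_of_subset_of_nonneg
    (fun i hi => Finset.mem_filter.2 ⟨Finset.mem_univ i, hs i hi⟩) fun i _ _ => hw i

theorem concentration_nonneg (hw : ∀ i, 0 ≤ w i) (δ : ℝ) : 0 ≤ concentration w y δ :=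
  Real.iSup_nonneg fun _ => Finset.sum_nonneg fun i _ => hw i

theorem concentration_mono (hw : ∀ i, 0 ≤ w i) {δ ε : ℝ} (h : δ ≤ ε) :
    concentration w y δ ≤ concentration w y ε :=
  concentration_le fun _ => sum_le_concentration hw fun _ hi =>
    Ico_subset_Ico_right (by linarith) (Finset.mem_filter.1 hi).2

theorem concentration_mul_le (hw : ∀ i, 0 ≤ w i) {r : ℝ} (hr : 0 < r) (δ : ℝ) :
    concentration w (fun i => y i * r) δ ≤ concentration w y (δ / r) := by
  refine concentration_le fun a => sum_le_concentration (a := a / r) hw fun i hi => ?_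
  obtain ⟨hl, hu⟩ := (Finset.mem_filter.1 hi).2
  rw [← add_div]
  exact ⟨(div_le_iff₀ hr).2 hl, (lt_div_iff₀ hr).2 hu⟩

theorem sum_mul_comp_le {α : Type*} [DecidableEq α] {g : ι → α} {s : Finset α}
    (hg : ∀ i, g i ∈ s) {Q : ℝ} (hQ : ∀ a, ∑ i with g i = a, w i ≤ Q) {f : α → ℝ}
    (hf : ∀ a, 0 ≤ f a) : ∑ i, w i * f (g i) ≤ Q * ∑ a ∈ s, f a := by
  rw [← Finset.sum_fiberwise_of_maps_to (t := s) fun i _ => hg i, Finset.mul_sum]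
  refine Finset.sum_le_sum fun a _ => ?_
  rw [Finset.sum_congr rfl (g := fun i => w i * f a) fun i hi => by
    rw [(Finset.mem_filter.1 hi).2], ← Finset.sum_mul]
  exact mul_le_mul_of_nonneg_right (hQ a) (hf a)

/-- The sum of `1 / (1 + l ^ 2)` over the integers, an absolute constant in the energy
estimates. -/
noncomputable def cauchySum : ℝ := ∑' l : ℤ, 1 / (1 + (l : ℝ) ^ 2)

theorem summable_one_div_one_add_int_sq : Summable fun l : ℤ => 1 / (1 + (l : ℝ) ^ 2) := by
  refine Summable.of_norm_bounded_eventually (g := fun l : ℤ => 1 / (l : ℝ) ^ 2)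
    (Real.summable_one_div_int_pow.2 one_lt_two) ?_
  filter_upwards [(finite_singleton (0 : ℤ)).compl_mem_cofinite] with l hl
  have hl' : (l : ℝ) ≠ 0 := by exact_mod_cast hl
  rw [Real.norm_of_nonneg (by positivity)]
  exact one_div_le_one_div_of_le (by positivity) (by linarith)

theorem cauchySum_nonneg : 0 ≤ cauchySum := tsum_nonneg fun l => by positivity

theorem one_div_one_add_sq_le_floor (u : ℝ) :
    1 / (1 + u ^ 2) ≤ 3 * (1 / (1 + (⌊u⌋ : ℝ) ^ 2)) := by
  have hu : Int.fract u ^ 2 ≤ 1 := pow_le_one₀ (Int.fract_nonneg u) (Int.fract_lt_one u).le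
  rw [mul_one_div, div_le_div_iff₀ (by positivity) (by positivity)]
  rw [Int.fract] at hu
  nlinarith [sq_nonneg (u + (u - ⌊u⌋)), sq_nonneg u]

theorem sum_mul_cauchyKernel_le (hw : ∀ i, 0 ≤ w i) (t : ℝ) :
    ∑ i, w i * (1 / (1 + (y i - t) ^ 2)) ≤ 3 * cauchySum * concentration w y 1 := by
  classical
  have hfiber (l : ℤ) : ∑ i with ⌊y i - t⌋ = l, w i ≤ concentration w y 1 := by
    refine sum_le_concentration (a := t + l) hw fun i hi => ?_
    obtain ⟨hl, hu⟩ := Int.floor_eq_iff.1 (Finset.mem_filter.1 hi).2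
    constructor <;> linarith
  calc ∑ i, w i * (1 / (1 + (y i - t) ^ 2))
      ≤ ∑ i, 3 * (w i * (1 / (1 + (⌊y i - t⌋ : ℝ) ^ 2))) := by
        refine Finset.sum_le_sum fun i _ => ?_
        rw [mul_left_comm]
        exact mul_le_mul_of_nonneg_left (one_div_one_add_sq_le_floor _) (hw i)
    _ ≤ 3 * (concentration w y 1 * cauchySum) := by
        rw [← Finset.mul_sum]
        refine mul_le_mul_of_nonneg_left ?_ zero_le_three
        refine (sum_mul_comp_le (f := fun l : ℤ => 1 / (1 + (l : ℝ) ^ 2))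
          (fun i => Finset.mem_image_of_mem _ (Finset.mem_univ i)) hfiber
          fun l => by positivity).trans ?_
        exact mul_le_mul_of_nonneg_left
          (summable_one_div_one_add_int_sq.sum_le_tsum _ fun l _ => by positivity)
          (concentration_nonneg hw 1)
    _ = 3 * cauchySum * concentration w y 1 := by ring

theorem sum_mul_fejerKernel_le (hw : ∀ i, 0 ≤ w i) {L : ℝ} (hL : 0 < L) (t : ℝ) :
    ∑ i, w i * fejerKernel L (t - y i) ≤ 12 * cauchySum * (L * concentration w y L⁻¹) := by
  calc ∑ i, w i * fejerKernel L (t - y i)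
      ≤ ∑ i, 4 * L * (w i * (1 / (1 + (y i * L - t * L) ^ 2))) := by
        refine Finset.sum_le_sum fun i _ => ?_
        refine (mul_le_mul_of_nonneg_left (fejerKernel_le hL.le _) (hw i)).trans_eq ?_
        ring
    _ ≤ 4 * L * (3 * cauchySum * concentration w y (1 / L)) := by
        rw [← Finset.mul_sum]
        refine mul_le_mul_of_nonneg_left ?_ (by positivity)
        refine (sum_mul_cauchyKernel_le hw _).trans ?_
        exact mul_le_mul_of_nonneg_left (concentration_mul_le hw hL 1)
          (mul_nonneg zero_le_three cauchySum_nonneg)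
    _ = 12 * cauchySum * (L * concentration w y L⁻¹) := by
        rw [one_div]
        ring

theorem integral_tent_mul_norm_sq_expSum_le {a : ι → ℝ} (ha : ∀ i, |a i| ≤ w i) {L : ℝ}
    (hL : 0 < L) :
    ∫ r in (0 : ℝ)..L, (1 - r / L) * ‖expSum a y r‖ ^ 2 ≤
      12 * cauchySum * (L * concentration w y L⁻¹) * ∑ i, w i := by
  have hw (i : ι) : 0 ≤ w i := (abs_nonneg _).trans (ha i)
  have hprod (i k : ι) : a i * a k ≤ w i * w k := by
    refine (le_abs_self _).trans ?_
    rw [abs_mul]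
    exact mul_le_mul (ha i) (ha k) (abs_nonneg _) (hw i)
  calc ∫ r in (0 : ℝ)..L, (1 - r / L) * ‖expSum a y r‖ ^ 2
      = ∑ i, ∑ k, a i * a k * fejerKernel L (y i - y k) :=
        integral_tent_mul_norm_sq_expSum a y hL.ne'
    _ ≤ ∑ i, w i * ∑ k, w k * fejerKernel L (y i - y k) := by
        simp only [Finset.mul_sum, ← mul_assoc]
        exact Finset.sum_le_sum fun i _ => Finset.sum_le_sum fun k _ =>
          mul_le_mul_of_nonneg_right (hprod i k) (fejerKernel_nonneg hL.le _)
    _ ≤ ∑ i, w i * (12 * cauchySum * (L * concentration w y L⁻¹)) :=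
        Finset.sum_le_sum fun i _ =>
          mul_le_mul_of_nonneg_left (sum_mul_fejerKernel_le hw hL _) (hw i)
    _ = _ := by rw [← Finset.sum_mul, mul_comm]

theorem integral_norm_sq_expSum_le_tent (a y : ι → ℝ) {T : ℝ} (hT : 0 < T) :
    ∫ r in (0 : ℝ)..T, ‖expSum a y r‖ ^ 2 ≤
      2 * ∫ r in (0 : ℝ)..2 * T, (1 - r / (2 * T)) * ‖expSum a y r‖ ^ 2 := by
  have hint (u v : ℝ) : IntervalIntegrable
      (fun r => 2 * ((1 - r / (2 * T)) * ‖expSum a y r‖ ^ 2)) volume u v :=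
    Continuous.intervalIntegrable (by fun_prop) _ _
  have hnonneg : 0 ≤ ∫ r in T..2 * T, 2 * ((1 - r / (2 * T)) * ‖expSum a y r‖ ^ 2) := by
    refine intervalIntegral.integral_nonneg (by linarith) fun r hr => ?_
    have : r / (2 * T) ≤ 1 := (div_le_one (by positivity)).2 hr.2
    exact mul_nonneg zero_le_two (mul_nonneg (by linarith) (by positivity))
  rw [← intervalIntegral.integral_const_mul,
    ← intervalIntegral.integral_add_adjacent_intervals (hint 0 T) (hint T (2 * T))]
  refine le_add_of_le_of_nonneg ?_ hnonneg
  refine intervalIntegral.integral_mono_on hT.le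
    (Continuous.intervalIntegrable (by fun_prop) _ _) (hint _ _) fun r hr => ?_
  have : r / (2 * T) ≤ 1 / 2 := by
    rw [div_le_div_iff₀ (by positivity) two_pos]
    linarith [hr.2]
  nlinarith [sq_nonneg ‖expSum a y r‖]

theorem integral_norm_sq_expSum_le {a : ι → ℝ} (ha : ∀ i, |a i| ≤ w i) {T : ℝ} (hT : 0 < T) :
    ∫ r in (0 : ℝ)..T, ‖expSum a y r‖ ^ 2 ≤
      48 * cauchySum * (T * concentration w y T⁻¹) * ∑ i, w i := by
  have hw (i : ι) : 0 ≤ w i := (abs_nonneg _).trans (ha i)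
  have hT2 : (2 * T)⁻¹ ≤ T⁻¹ := inv_anti₀ hT (by linarith)
  calc ∫ r in (0 : ℝ)..T, ‖expSum a y r‖ ^ 2
      ≤ 2 * (12 * cauchySum * (2 * T * concentration w y (2 * T)⁻¹) * ∑ i, w i) :=
        (integral_norm_sq_expSum_le_tent a y hT).trans <| mul_le_mul_of_nonneg_left
          (integral_tent_mul_norm_sq_expSum_le ha (by positivity)) zero_le_two
    _ = 48 * cauchySum * (T * concentration w y (2 * T)⁻¹) * ∑ i, w i := by ring
    _ ≤ 48 * cauchySum * (T * concentration w y T⁻¹) * ∑ i, w i := by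
        have := cauchySum_nonneg
        have := Finset.sum_nonneg fun i (_ : i ∈ Finset.univ) => hw i
        gcongr
        exact concentration_mono hw hT2

end Concentration

section LargeSieve

theorem le_integral_add_abs_deriv {g g' : ℝ → ℝ} (hg : ∀ r, HasDerivAt g (g' r) r)
    (hg' : Continuous g') {l t : ℝ} (ht : t ∈ Icc l (l + 1)) :
    g t ≤ ∫ r in l..(l + 1), (g r + |g' r|) := by
  have hgc : Continuous g := continuous_iff_continuousAt.2 fun r => (hg r).continuousAt
  have osc (s : ℝ) (hs : s ∈ Icc l (l + 1)) : g t ≤ g s + ∫ r in l..(l + 1), |g' r| := by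
    have hderiv : ∫ r in s..t, g' r = g t - g s :=
      intervalIntegral.integral_eq_sub_of_hasDerivAt (fun r _ => hg r)
        (hg'.intervalIntegrable _ _)
    have habs : |∫ r in s..t, g' r| ≤ abs (∫ r in s..t, |g' r|) :=
      intervalIntegral.norm_integral_le_abs_integral_norm (f := g')
    have hmono : abs (∫ r in s..t, |g' r|) ≤ abs (∫ r in l..(l + 1), |g' r|) := by
      refine intervalIntegral.abs_integral_mono_interval ?_
        (Eventually.of_forall fun r => abs_nonneg _) (hg'.abs.intervalIntegrable _ _)
      rw [uIoc_of_le (by linarith : l ≤ l + 1)]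
      exact Ioc_subset_Ioc (le_min hs.1 ht.1) (max_le hs.2 ht.2)
    rw [abs_of_nonneg (a := ∫ r in l..(l + 1), |g' r|)
      (intervalIntegral.integral_nonneg (by linarith) fun r _ => abs_nonneg _)] at hmono
    linarith [le_abs_self (∫ r in s..t, g' r)]
  have hint := intervalIntegral.integral_mono_on (μ := volume) (by linarith : l ≤ l + 1)
    (continuous_const.intervalIntegrable _ _)
    ((hgc.fun_add continuous_const).intervalIntegrable _ _) osc
  rw [intervalIntegral.integral_add (hgc.intervalIntegrable _ _)
    (continuous_const.intervalIntegrable _ _)] at hint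
  rw [intervalIntegral.integral_add (hgc.intervalIntegrable _ _)
    (hg'.abs.intervalIntegrable _ _)]
  simpa using hint

variable {ι κ : Type*} [Fintype ι] [Fintype κ]

theorem norm_sq_expSum_le_integral (a y : ι → ℝ) {l t : ℝ} (ht : t ∈ Icc l (l + 1)) :
    ‖expSum a y t‖ ^ 2 ≤
      ∫ r in l..(l + 1), (2 * ‖expSum a y r‖ ^ 2 + ‖expSum (a * y) y r‖ ^ 2) := by
  refine (le_integral_add_abs_deriv (fun r => (hasDerivAt_expSum a y r).norm_sq)
    (by fun_prop) ht).trans ?_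
  refine intervalIntegral.integral_mono_on (by linarith)
    (Continuous.intervalIntegrable (by fun_prop) _ _)
    (Continuous.intervalIntegrable (by fun_prop) _ _) fun r _ => ?_
  have hinner := abs_real_inner_le_norm (expSum a y r) (Complex.I * expSum (a * y) y r)
  rw [norm_mul, Complex.norm_I, one_mul] at hinner
  rw [abs_mul, abs_two]
  nlinarith [sq_nonneg (‖expSum a y r‖ - ‖expSum (a * y) y r‖)]

theorem integral_norm_sq_expSum_add_deriv_le {b v : ι → ℝ} (hb : ∀ i, 0 ≤ b i)
    (hv : ∀ i, |v i| ≤ 1) {T : ℝ} (hT : 0 < T) :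
    ∫ r in (0 : ℝ)..T, (2 * ‖expSum b v r‖ ^ 2 + ‖expSum (b * v) v r‖ ^ 2) ≤
      144 * cauchySum * (T * concentration b v T⁻¹) * ∑ i, b i := by
  rw [intervalIntegral.integral_add (Continuous.intervalIntegrable (by fun_prop) _ _)
    (Continuous.intervalIntegrable (by fun_prop) _ _), intervalIntegral.integral_const_mul]
  have hfun := integral_norm_sq_expSum_le (y := v) (fun i => (abs_of_nonneg (hb i)).le) hT
  have hderiv := integral_norm_sq_expSum_le (w := b) (a := b * v) (y := v) (fun i => by
    rw [Pi.mul_apply, abs_mul, abs_of_nonneg (hb i)]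
    exact mul_le_of_le_one_right (hb i) (hv i)) hT
  linarith

/-- A large sieve inequality: by the Sobolev inequality on unit intervals, sampling at points with
few of them in each unit interval is controlled by the integral. -/
theorem sum_mul_norm_sq_expSum_le {b v : ι → ℝ} (hb : ∀ i, 0 ≤ b i) (hv : ∀ i, |v i| ≤ 1)
    {c z : κ → ℝ} (hc : ∀ k, 0 ≤ c k) {n : ℕ} (hn : 0 < n) (hz : ∀ k, z k ∈ Ico (0 : ℝ) n) :
    ∑ k, c k * ‖expSum b v (z k)‖ ^ 2 ≤
      concentration c z 1 * (144 * cauchySum * (n * concentration b v (n : ℝ)⁻¹) * ∑ i, b i) := by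
  classical
  set h : ℝ → ℝ := fun r => 2 * ‖expSum b v r‖ ^ 2 + ‖expSum (b * v) v r‖ ^ 2
  have h_cont : Continuous h := by fun_prop
  have floor_mem (k : κ) : ⌊z k⌋₊ ∈ Finset.range n :=
    Finset.mem_range.2 ((Nat.floor_lt (hz k).1).2 (hz k).2)
  have hfiber (l : ℕ) : ∑ k with ⌊z k⌋₊ = l, c k ≤ concentration c z 1 :=
    sum_le_concentration hc fun k hk => (Nat.floor_eq_iff (hz k).1).1 (Finset.mem_filter.1 hk).2
  calc ∑ k, c k * ‖expSum b v (z k)‖ ^ 2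
      ≤ ∑ k, c k * ∫ r in (⌊z k⌋₊ : ℝ)..((⌊z k⌋₊ + 1 : ℕ) : ℝ), h r := by
        refine Finset.sum_le_sum fun k _ => mul_le_mul_of_nonneg_left ?_ (hc k)
        rw [Nat.cast_add_one]
        exact norm_sq_expSum_le_integral b v
          ⟨Nat.floor_le (hz k).1, (Nat.lt_floor_add_one _).le⟩
    _ ≤ concentration c z 1 * ∑ l ∈ Finset.range n, ∫ r in (l : ℝ)..((l + 1 : ℕ) : ℝ), h r :=
        sum_mul_comp_le (f := fun l : ℕ => ∫ r in (l : ℝ)..((l + 1 : ℕ) : ℝ), h r)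
          floor_mem hfiber fun l =>
          intervalIntegral.integral_nonneg (by simp) fun r _ => by positivity
    _ = concentration c z 1 * ∫ r in (0 : ℝ)..n, h r := by
        rw [intervalIntegral.sum_integral_adjacent_intervals (a := fun l : ℕ => (l : ℝ))
          fun k _ => h_cont.intervalIntegrable _ _, Nat.cast_zero]
    _ ≤ _ := mul_le_mul_of_nonneg_left
        (integral_norm_sq_expSum_add_deriv_le hb hv (Nat.cast_pos.2 hn))
        (concentration_nonneg hc 1)

end LargeSieve

section AveragedEnergy

variable {ι κ τ : Type*} [Fintype ι] [Fintype κ] [Fintype τ]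

theorem sum_mul_norm_sq_expSum_mul_le {b v : κ → ℝ} (hb : ∀ j, 0 ≤ b j) (hv : ∀ j, |v j| ≤ 1)
    {c x : τ → ℝ} (hc : ∀ k, 0 ≤ c k) (hx : ∀ k, x k ∈ Icc (0 : ℝ) 1) {T r : ℝ} (hT : 1 ≤ T)
    (hr : r ∈ Icc T (2 * T)) :
    ∑ k, c k * ‖expSum b v (x k * r)‖ ^ 2 ≤
      432 * cauchySum * T * concentration b v T⁻¹ * concentration c x T⁻¹ * ∑ j, b j := by
  have hr0 : 0 < r := by linarith [hr.1]
  set n : ℕ := ⌊2 * T⌋₊ + 1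
  have hn : 2 * T < n := by
    push_cast [n]
    exact Nat.lt_floor_add_one _
  have hn3 : (n : ℝ) ≤ 3 * T := by
    push_cast [n]
    linarith [Nat.floor_le (by linarith : 0 ≤ 2 * T)]
  have hz (k : τ) : x k * r ∈ Ico (0 : ℝ) n :=
    ⟨mul_nonneg (hx k).1 hr0.le,
      (mul_le_of_le_one_left hr0.le (hx k).2).trans_lt (hr.2.trans_lt hn)⟩
  have hconc_x : concentration c (fun k => x k * r) 1 ≤ concentration c x T⁻¹ :=
    (concentration_mul_le hc hr0 1).trans <| concentration_mono hc <| by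
      rw [one_div]
      exact inv_anti₀ (by linarith) hr.1
  have hconc_v : concentration b v (n : ℝ)⁻¹ ≤ concentration b v T⁻¹ :=
    concentration_mono hb (inv_anti₀ (by linarith) (by linarith))
  have hcs := cauchySum_nonneg
  have hQ := concentration_nonneg (y := v) hb (n : ℝ)⁻¹
  have hQ' := concentration_nonneg (y := x) hc T⁻¹
  have hbs := Finset.sum_nonneg fun j (_ : j ∈ Finset.univ) => hb j
  calc ∑ k, c k * ‖expSum b v (x k * r)‖ ^ 2
      ≤ concentration c (fun k => x k * r) 1 *
          (144 * cauchySum * (n * concentration b v (n : ℝ)⁻¹) * ∑ j, b j) :=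
        sum_mul_norm_sq_expSum_le hb hv hc (Nat.succ_pos _) hz
    _ ≤ concentration c x T⁻¹ *
          (144 * cauchySum * (3 * T * concentration b v T⁻¹) * ∑ j, b j) := by
        gcongr
    _ = _ := by ring

theorem integral_dyadic_block_le {a u : ι → ℝ} (ha : ∀ i, 0 ≤ a i)
    {b v : κ → ℝ} (hb : ∀ j, 0 ≤ b j) (hv : ∀ j, |v j| ≤ 1)
    {c x : τ → ℝ} (hc : ∀ k, 0 ≤ c k) (hx : ∀ k, x k ∈ Icc (0 : ℝ) 1) {T : ℝ} (hT : 1 ≤ T) :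
    ∫ r in T..2 * T, ‖expSum a u r‖ ^ 2 * ∑ k, c k * ‖expSum b v (x k * r)‖ ^ 2 ≤
      41472 * cauchySum ^ 2 * (∑ i, a i) * (∑ j, b j) * T ^ 2 *
        (concentration a u T⁻¹ * concentration b v T⁻¹ * concentration c x T⁻¹) := by
  have hT0 : 0 < T := by linarith
  have hint (l m : ℝ) : IntervalIntegrable (fun r => ‖expSum a u r‖ ^ 2) volume l m :=
    Continuous.intervalIntegrable (by fun_prop) _ _
  set S := 432 * cauchySum * T * concentration b v T⁻¹ * concentration c x T⁻¹ * ∑ j, b j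
  have hcs := cauchySum_nonneg
  have hQb := concentration_nonneg (y := v) hb T⁻¹
  have hQc := concentration_nonneg (y := x) hc T⁻¹
  have has := Finset.sum_nonneg fun i (_ : i ∈ Finset.univ) => ha i
  have hbs := Finset.sum_nonneg fun j (_ : j ∈ Finset.univ) => hb j
  calc ∫ r in T..2 * T, ‖expSum a u r‖ ^ 2 * ∑ k, c k * ‖expSum b v (x k * r)‖ ^ 2
      ≤ ∫ r in T..2 * T, ‖expSum a u r‖ ^ 2 * S :=
        intervalIntegral.integral_mono_on (by linarith)
          (Continuous.intervalIntegrable (by fun_prop) _ _) ((hint _ _).mul_const _) fun r hr =>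
          mul_le_mul_of_nonneg_left (sum_mul_norm_sq_expSum_mul_le hb hv hc hx hT hr)
            (by positivity)
    _ = (∫ r in T..2 * T, ‖expSum a u r‖ ^ 2) * S := intervalIntegral.integral_mul_const _ _
    _ ≤ (∫ r in (0 : ℝ)..2 * T, ‖expSum a u r‖ ^ 2) * S := by
        refine mul_le_mul_of_nonneg_right ?_ (by positivity)
        rw [← intervalIntegral.integral_add_adjacent_intervals (hint 0 T) (hint T _)]
        exact le_add_of_nonneg_left
          (intervalIntegral.integral_nonneg hT0.le fun r _ => by positivity)
    _ ≤ 48 * cauchySum * (2 * T * concentration a u (2 * T)⁻¹) * (∑ i, a i) * S :=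
        mul_le_mul_of_nonneg_right
          (integral_norm_sq_expSum_le (fun i => (abs_of_nonneg (ha i)).le) (by positivity))
          (by positivity)
    _ ≤ 48 * cauchySum * (2 * T * concentration a u T⁻¹) * (∑ i, a i) * S := by
        gcongr
        exact concentration_mono ha (inv_anti₀ hT0 (by linarith))
    _ = _ := by
        simp only [S]
        ring

end AveragedEnergy

section FrostmanEnergy

/-- A discrete Frostman measure at scale `2⁻ⁿ`: the masses `w i` at the points `y i` form a
probability measure, and an interval of length `δ = 2⁻ᵐ` with `m ≤ n` has mass at most `C δ ^ s`. -/
structure IsFrostmanWeight {ι : Type*} [Fintype ι] (C s : ℝ) (n : ℕ) (w y : ι → ℝ) : Prop where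
  nonneg (i : ι) : 0 ≤ w i
  sum_eq_one : ∑ i, w i = 1
  concentration_le (m : ℕ) (hm : m ≤ n) : concentration w y (2 ^ m)⁻¹ ≤ C * ((2 : ℝ) ^ m)⁻¹ ^ s

theorem IsFrostmanWeight.const_nonneg {ι : Type*} [Fintype ι] {C s : ℝ} {n : ℕ} {w y : ι → ℝ}
    (h : IsFrostmanWeight C s n w y) : 0 ≤ C := by
  simpa using (concentration_nonneg h.nonneg _).trans (h.concentration_le 0 n.zero_le)

/-- The bound of `integral_norm_sq_mul_le` when `K` is the product of the Frostman constants and `p`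
is the amount by which the sum of the exponents exceeds `2`. -/
noncomputable def energyBound (K p : ℝ) : ℝ :=
  1 + 41472 * cauchySum ^ 2 * K / (1 - (1 / 2) ^ p)

theorem energyBound_pos {K p : ℝ} (hK : 0 ≤ K) (hp : 0 < p) : 0 < energyBound K p := by
  have hhalf : (1 / 2 : ℝ) ^ p < 1 := Real.rpow_lt_one (by norm_num) (by norm_num) hp
  exact add_pos_of_pos_of_nonneg one_pos (div_nonneg (by positivity) (by linarith))

variable {ι κ τ : Type*} [Fintype ι] [Fintype κ] [Fintype τ] {A B C α β γ : ℝ} {n : ℕ}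
  {a y : ι → ℝ} {b v : κ → ℝ} {c x : τ → ℝ}

theorem integral_dyadic_block_le_geometric (ha : IsFrostmanWeight A α n a y)
    (hb : IsFrostmanWeight B β n b v) (hc : IsFrostmanWeight C γ n c x) (hv : ∀ j, |v j| ≤ 1)
    (hx : ∀ k, x k ∈ Icc (0 : ℝ) 1) {j : ℕ} (hj : j ≤ n) :
    ∫ r in (2 : ℝ) ^ j..2 ^ (j + 1),
        ‖expSum a y r‖ ^ 2 * ∑ k, c k * ‖expSum b v (x k * r)‖ ^ 2 ≤
      41472 * cauchySum ^ 2 * (A * B * C) * ((1 / 2) ^ (α + β + γ - 2)) ^ j := by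
  have hδ : (0 : ℝ) < (2 ^ j)⁻¹ := by positivity
  have hblock := integral_dyadic_block_le ha.nonneg (u := y) hb.nonneg hv hc.nonneg hx
    (one_le_pow₀ one_le_two : (1 : ℝ) ≤ 2 ^ j)
  rw [ha.sum_eq_one, hb.sum_eq_one, mul_one, mul_one, ← pow_succ'] at hblock
  refine hblock.trans ?_
  calc 41472 * cauchySum ^ 2 * (2 ^ j) ^ 2 * (concentration a y (2 ^ j)⁻¹ *
          concentration b v (2 ^ j)⁻¹ * concentration c x (2 ^ j)⁻¹)
      ≤ 41472 * cauchySum ^ 2 * (2 ^ j) ^ 2 * ((A * ((2 : ℝ) ^ j)⁻¹ ^ α) *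
          (B * ((2 : ℝ) ^ j)⁻¹ ^ β) * (C * ((2 : ℝ) ^ j)⁻¹ ^ γ)) := by
        have := ha.const_nonneg
        have := hb.const_nonneg
        have := concentration_nonneg (y := v) hb.nonneg (2 ^ j)⁻¹
        have := concentration_nonneg (y := x) hc.nonneg (2 ^ j)⁻¹
        gcongr
        exacts [ha.concentration_le j hj, hb.concentration_le j hj, hc.concentration_le j hj]
    _ = 41472 * cauchySum ^ 2 * (A * B * C) * ((2 : ℝ) ^ j)⁻¹ ^ (α + β + γ - 2) := by
        rw [Real.rpow_sub hδ, Real.rpow_add hδ, Real.rpow_add hδ, Real.rpow_two]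
        field_simp
    _ = 41472 * cauchySum ^ 2 * (A * B * C) * ((1 / 2) ^ (α + β + γ - 2)) ^ j := by
        rw [← inv_pow, ← one_div, Real.rpow_pow_comm (by norm_num)]

theorem integral_norm_sq_mul_le (ha : IsFrostmanWeight A α n a y)
    (hb : IsFrostmanWeight B β n b v) (hc : IsFrostmanWeight C γ n c x) (hv : ∀ j, |v j| ≤ 1)
    (hx : ∀ k, x k ∈ Icc (0 : ℝ) 1) (hsum : 2 < α + β + γ) :
    ∫ r in (0 : ℝ)..2 ^ n, ‖expSum a y r‖ ^ 2 * ∑ k, c k * ‖expSum b v (x k * r)‖ ^ 2 ≤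
      energyBound (A * B * C) (α + β + γ - 2) := by
  set f : ℝ → ℝ := fun r => ‖expSum a y r‖ ^ 2 * ∑ k, c k * ‖expSum b v (x k * r)‖ ^ 2
  have hint (l m : ℝ) : IntervalIntegrable f volume l m :=
    Continuous.intervalIntegrable (by fun_prop) _ _
  have hf (r : ℝ) : f r ≤ 1 := by
    have hay : ‖expSum a y r‖ ^ 2 ≤ 1 :=
      pow_le_one₀ (norm_nonneg _) (ha.sum_eq_one ▸ norm_expSum_le ha.nonneg r)
    have hbv (k : τ) : ‖expSum b v (x k * r)‖ ^ 2 ≤ 1 :=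
      pow_le_one₀ (norm_nonneg _) (hb.sum_eq_one ▸ norm_expSum_le hb.nonneg _)
    refine mul_le_one₀ hay (Finset.sum_nonneg fun k _ => mul_nonneg (hc.nonneg k)
      (by positivity)) ?_
    rw [← hc.sum_eq_one]
    exact Finset.sum_le_sum fun k _ => mul_le_of_le_one_right (hc.nonneg k) (hbv k)
  have hone : ∫ r in (0 : ℝ)..1, f r ≤ 1 := by
    simpa using intervalIntegral.integral_mono_on zero_le_one (hint _ _)
      (continuous_const.intervalIntegrable _ _) fun r _ => hf r
  set K := 41472 * cauchySum ^ 2 * (A * B * C)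
  have hK : 0 ≤ K := by
    have := mul_nonneg (mul_nonneg ha.const_nonneg hb.const_nonneg) hc.const_nonneg
    positivity
  have hq : (1 / 2 : ℝ) ^ (α + β + γ - 2) < 1 :=
    Real.rpow_lt_one (by norm_num) (by norm_num) (by linarith)
  calc ∫ r in (0 : ℝ)..2 ^ n, f r
      = (∫ r in (0 : ℝ)..1, f r) + ∑ j ∈ Finset.range n, ∫ r in (2 : ℝ) ^ j..2 ^ (j + 1), f r := by
        rw [intervalIntegral.sum_integral_adjacent_intervals (a := fun j => (2 : ℝ) ^ j)
          fun j _ => hint _ _, pow_zero, intervalIntegral.integral_add_adjacent_intervals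
          (hint _ _) (hint _ _)]
    _ ≤ 1 + ∑ j ∈ Finset.range n, K * ((1 / 2) ^ (α + β + γ - 2)) ^ j :=
        add_le_add hone <| Finset.sum_le_sum fun j hj =>
          integral_dyadic_block_le_geometric ha hb hc hv hx (Finset.mem_range.1 hj).le
    _ ≤ energyBound (A * B * C) (α + β + γ - 2) := by
        rw [energyBound, ← Finset.mul_sum, div_eq_mul_inv (_ * _),
          ← tsum_geometric_of_lt_one (by positivity) hq]
        gcongr
        exact (summable_geometric_of_lt_one (by positivity) hq).sum_le_tsum _
          fun j _ => by positivity

end FrostmanEnergy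

section Collisions

variable {ι : Type*} [Fintype ι] {b t : ι → ℝ}

theorem sum_close_mul_le_integral (hb : ∀ i, 0 ≤ b i) {L : ℝ} (hL : 0 < L) :
    ∑ i, ∑ k with |t i - t k| ≤ L⁻¹, b i * b k ≤
      L⁻¹ * (4 * ∫ r in (0 : ℝ)..L, ‖expSum b t r‖ ^ 2) := by
  have hkernel {i k : ι} (h : |t i - t k| ≤ L⁻¹) :
      1 ≤ 4 * L⁻¹ * fejerKernel L (t i - t k) := by
    have hL1 : |L * (t i - t k)| ≤ 1 := by
      rwa [abs_mul, abs_of_pos hL, mul_comm, ← le_div_iff₀ hL, one_div]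
    calc (1 : ℝ) = 4 * L⁻¹ * (L / 4) := by field_simp
      _ ≤ _ := mul_le_mul_of_nonneg_left (le_fejerKernel hL.le hL1) (by positivity)
  calc ∑ i, ∑ k with |t i - t k| ≤ L⁻¹, b i * b k
      ≤ ∑ i, ∑ k, 4 * L⁻¹ * (b i * b k * fejerKernel L (t i - t k)) := by
        refine Finset.sum_le_sum fun i _ => ?_
        refine (Finset.sum_le_sum fun k hk => ?_).trans <|
          Finset.sum_le_univ_sum_of_nonneg fun k => ?_
        · rw [mul_left_comm]
          exact le_mul_of_one_le_right (mul_nonneg (hb i) (hb k))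
            (hkernel (Finset.mem_filter.1 hk).2)
        · have := fejerKernel_nonneg hL.le (t i - t k)
          have := mul_nonneg (hb i) (hb k)
          positivity
    _ = L⁻¹ * (4 * ∫ r in (0 : ℝ)..L, (1 - r / L) * ‖expSum b t r‖ ^ 2) := by
        simp only [integral_tent_mul_norm_sq_expSum b t hL.ne', Finset.mul_sum]
        refine Finset.sum_congr rfl fun i _ => Finset.sum_congr rfl fun k _ => ?_
        ring
    _ ≤ L⁻¹ * (4 * ∫ r in (0 : ℝ)..L, ‖expSum b t r‖ ^ 2) := by
        gcongr
        refine intervalIntegral.integral_mono_on hL.le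
          (Continuous.intervalIntegrable (by fun_prop) _ _)
          (Continuous.intervalIntegrable (by fun_prop) _ _) fun r hr => ?_
        exact mul_le_of_le_one_left (by positivity) (sub_le_self _ (div_nonneg hr.1 hL.le))

theorem sq_sum_le_card_mul_sum_close (hb : ∀ i, 0 ≤ b i) {δ : ℝ} (hδ : 0 < δ) :
    (∑ i, b i) ^ 2 ≤ (Finset.univ.image fun i => ⌊t i / δ⌋).card *
      ∑ i, ∑ k with |t i - t k| ≤ δ, b i * b k := by
  classical
  set I := Finset.univ.image fun i => ⌊t i / δ⌋
  have hmaps (i : ι) (hi : i ∈ Finset.univ) : ⌊t i / δ⌋ ∈ I := Finset.mem_image_of_mem _ hi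
  have hclose {i k : ι} (h : ⌊t k / δ⌋ = ⌊t i / δ⌋) : |t i - t k| ≤ δ := by
    have := (Int.abs_sub_lt_one_of_floor_eq_floor h.symm).le
    rwa [← sub_div, abs_div, abs_of_pos hδ, div_le_one hδ] at this
  calc (∑ i, b i) ^ 2 = (∑ l ∈ I, ∑ i with ⌊t i / δ⌋ = l, b i) ^ 2 := by
        rw [Finset.sum_fiberwise_of_maps_to hmaps]
    _ ≤ I.card * ∑ l ∈ I, (∑ i with ⌊t i / δ⌋ = l, b i) ^ 2 := sq_sum_le_card_mul_sum_sq
    _ ≤ I.card * ∑ i, ∑ k with |t i - t k| ≤ δ, b i * b k := by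
        rw [← Finset.sum_fiberwise_of_maps_to hmaps]
        refine mul_le_mul_of_nonneg_left (Finset.sum_le_sum fun l _ => ?_) (Nat.cast_nonneg _)
        rw [sq, Finset.sum_mul_sum]
        refine Finset.sum_le_sum fun i hi => Finset.sum_le_sum_of_subset_of_nonneg (fun k hk => ?_)
          fun k _ _ => mul_nonneg (hb i) (hb k)
        simp only [Finset.mem_filter, Finset.mem_univ, true_and] at hi hk ⊢
        exact hclose (hk.trans hi.symm)

theorem card_mul_le_volume_cthickening (t : ι → ℝ) {δ : ℝ} (hδ : 0 < δ) :
    (Finset.univ.image fun i => ⌊t i / δ⌋).card * ENNReal.ofReal δ ≤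
      volume (Metric.cthickening δ (range t)) := by
  set I := Finset.univ.image fun i => ⌊t i / δ⌋
  have mem_cell (l : ℤ) (s : ℝ) : s ∈ Ico (l * δ) ((l + 1) * δ) ↔ ⌊s / δ⌋ = l := by
    rw [Int.floor_eq_iff, le_div_iff₀ hδ, div_lt_iff₀ hδ, mem_Ico]
  have hsub : (⋃ l ∈ I, Ico ((l : ℝ) * δ) ((l + 1) * δ)) ⊆ Metric.cthickening δ (range t) := by
    intro s hs
    simp only [mem_iUnion, mem_cell] at hs
    obtain ⟨l, hl, rfl⟩ := hs
    obtain ⟨i, -, hi⟩ := Finset.mem_image.1 hl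
    refine Metric.mem_cthickening_of_dist_le s (t i) δ _ ⟨i, rfl⟩ ?_
    have := (Int.abs_sub_lt_one_of_floor_eq_floor hi.symm).le
    rwa [← sub_div, abs_div, abs_of_pos hδ, div_le_one hδ, ← Real.dist_eq] at this
  refine le_trans (le_of_eq ?_) (measure_mono hsub)
  rw [measure_biUnion_finset (fun l _ l' _ hne => disjoint_left.2 fun s hs hs' =>
    hne (((mem_cell l s).1 hs).symm.trans ((mem_cell l' s).1 hs'))) fun l _ => measurableSet_Ico]
  simp only [Real.volume_Ico, add_mul, one_mul, add_sub_cancel_left, Finset.sum_const,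
    nsmul_eq_mul]

theorem sq_sum_le_integral_mul_volume (hb : ∀ i, 0 ≤ b i) {L : ℝ} (hL : 0 < L) :
    ENNReal.ofReal ((∑ i, b i) ^ 2) ≤
      ENNReal.ofReal (4 * ∫ r in (0 : ℝ)..L, ‖expSum b t r‖ ^ 2) *
        volume (Metric.cthickening L⁻¹ (range t)) := by
  set N := (Finset.univ.image fun i => ⌊t i / L⁻¹⌋).card
  calc ENNReal.ofReal ((∑ i, b i) ^ 2)
      ≤ ENNReal.ofReal (N * (L⁻¹ * (4 * ∫ r in (0 : ℝ)..L, ‖expSum b t r‖ ^ 2))) :=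
        ENNReal.ofReal_le_ofReal <| (sq_sum_le_card_mul_sum_close hb (inv_pos.2 hL)).trans <|
          mul_le_mul_of_nonneg_left (sum_close_mul_le_integral hb hL) (Nat.cast_nonneg _)
    _ = ENNReal.ofReal (4 * ∫ r in (0 : ℝ)..L, ‖expSum b t r‖ ^ 2) *
          (N * ENNReal.ofReal L⁻¹) := by
        rw [ENNReal.ofReal_mul (Nat.cast_nonneg _), ENNReal.ofReal_natCast,
          ENNReal.ofReal_mul (inv_pos.2 hL).le]
        ring
    _ ≤ _ := mul_le_mul_right (card_mul_le_volume_cthickening t (inv_pos.2 hL)) _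

theorem exists_le_of_sum_mul_le {c f : ι → ℝ} {M : ℝ} (hc : ∀ k, 0 ≤ c k) (hsum : ∑ k, c k = 1)
    (hM : ∑ k, c k * f k ≤ M) : ∃ k, f k ≤ M := by
  by_contra! hlt
  obtain ⟨k, -, hk⟩ : ∃ k ∈ Finset.univ, c k ≠ 0 :=
    Finset.exists_ne_zero_of_sum_ne_zero (hsum ▸ one_ne_zero)
  have : ∑ k, c k * M < ∑ k, c k * f k :=
    Finset.sum_lt_sum (fun k _ => mul_le_mul_of_nonneg_left (hlt k).le (hc k))
      ⟨k, Finset.mem_univ k, mul_lt_mul_of_pos_left (hlt k) ((hc k).lt_of_ne' hk)⟩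
  rw [← Finset.sum_mul, hsum, one_mul] at this
  linarith

/-- A discrete form of Falconer's exceptional set estimate for projections. -/
theorem exists_le_volume_cthickening {κ τ : Type*} [Fintype κ] [Fintype τ] {A B C α β γ : ℝ}
    {n : ℕ} {a y : ι → ℝ} {b v : κ → ℝ} {c x : τ → ℝ} (ha : IsFrostmanWeight A α n a y)
    (hb : IsFrostmanWeight B β n b v) (hc : IsFrostmanWeight C γ n c x) (hv : ∀ j, |v j| ≤ 1)
    (hx : ∀ k, x k ∈ Icc (0 : ℝ) 1) (hsum : 2 < α + β + γ) :
    ∃ k, (ENNReal.ofReal (4 * energyBound (A * B * C) (α + β + γ - 2)))⁻¹ ≤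
      volume (Metric.cthickening (2 ^ n)⁻¹ (range fun p : ι × κ => y p.1 + x k * v p.2)) := by
  set M := energyBound (A * B * C) (α + β + γ - 2)
  have hM : 0 < M := energyBound_pos
    (mul_nonneg (mul_nonneg ha.const_nonneg hb.const_nonneg) hc.const_nonneg) (by linarith)
  have hL : (0 : ℝ) < 2 ^ n := by positivity
  set m : ι × κ → ℝ := fun p => a p.1 * b p.2
  have hm (p : ι × κ) : 0 ≤ m p := mul_nonneg (ha.nonneg _) (hb.nonneg _)
  have hm_sum : ∑ p, m p = 1 := by
    simp only [m, Fintype.sum_prod_type, ← Finset.mul_sum, hb.sum_eq_one, mul_one, ha.sum_eq_one]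
  have havg : ∑ k, c k * ∫ r in (0 : ℝ)..2 ^ n,
      ‖expSum m (fun p => y p.1 + x k * v p.2) r‖ ^ 2 ≤ M := by
    refine le_of_eq_of_le ?_ (integral_norm_sq_mul_le ha hb hc hv hx hsum)
    simp only [m, expSum_prod, norm_mul, mul_pow, ← intervalIntegral.integral_const_mul,
      Finset.mul_sum]
    rw [intervalIntegral.integral_finsetSum fun k _ =>
      Continuous.intervalIntegrable (by fun_prop) _ _]
    simp only [mul_left_comm]
  obtain ⟨k, hk⟩ := exists_le_of_sum_mul_le hc.nonneg hc.sum_eq_one havg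
  refine ⟨k, (ENNReal.inv_le_iff_le_mul (fun _ => ?_) fun h => absurd h ENNReal.ofReal_ne_top).2 ?_⟩
  · exact (ENNReal.ofReal_pos.2 (by positivity)).ne'
  · calc (1 : ℝ≥0∞) = ENNReal.ofReal ((∑ p, m p) ^ 2) := by simp [hm_sum]
      _ ≤ _ := sq_sum_le_integral_mul_volume hm hL
      _ ≤ _ := by gcongr

end Collisions

section Frostman

theorem exists_le_sum_ediam_rpow {X : Type*} [EMetricSpace X] [MeasurableSpace X] [BorelSpace X]
    {K : Set X} {s : ℝ≥0} (hs : 0 < s) (hK : (s : ℝ≥0∞) < dimH K) :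
    ∃ c : ℝ≥0, 0 < c ∧ ∀ (κ : Type) [Fintype κ] (t : κ → Set X), K ⊆ ⋃ i, t i →
      (c : ℝ≥0∞) ≤ ∑ i, Metric.ediam (t i) ^ (s : ℝ) := by
  by_contra! hsmall
  have hε (k : ℕ) : (0 : ℝ≥0) < 1 / ((k : ℝ≥0) + 1) := by positivity
  choose κ _ t hcover hlt using fun k => hsmall _ (hε k)
  have hlim : Tendsto (fun k : ℕ => ((1 / ((k : ℝ≥0) + 1) : ℝ≥0) : ℝ≥0∞)) atTop (𝓝 0) := by
    have h : Tendsto (fun k : ℕ => 1 / ((k : ℝ≥0) + 1)) atTop (𝓝 0) :=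
      tendsto_one_div_add_atTop_nhds_zero_nat
    exact ENNReal.tendsto_coe.2 h
  have hlim' := ENNReal.continuous_rpow_const (y := (s : ℝ)⁻¹) |>.tendsto 0 |>.comp hlim
  rw [ENNReal.zero_rpow_of_pos (by positivity)] at hlim'
  have hdiam (k : ℕ) (i : κ k) :
      Metric.ediam (t k i) ≤ ((1 / ((k : ℝ≥0) + 1) : ℝ≥0) : ℝ≥0∞) ^ (s : ℝ)⁻¹ := by
    rw [ENNReal.le_rpow_inv_iff (by positivity)]
    exact (Finset.single_le_sum_of_canonicallyOrdered (Finset.mem_univ i)).trans (hlt k).le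
  have hzero : μH[s] K ≤ 0 := calc
    μH[s] K ≤ liminf (fun k => ∑ i, Metric.ediam (t k i) ^ (s : ℝ)) atTop :=
      Measure.hausdorffMeasure_le_liminf_sum _ K _ hlim' t (.of_forall hdiam) (.of_forall hcover)
    _ ≤ liminf (fun k : ℕ => ((1 / ((k : ℝ≥0) + 1) : ℝ≥0) : ℝ≥0∞)) atTop :=
      liminf_le_liminf (.of_forall fun k => (hlt k).le)
    _ = 0 := hlim.liminf_eq
  simp [hausdorffMeasure_of_lt_dimH hK] at hzero

theorem exists_saturated_weight {ι κ : Type*} [Finite ι] [Finite κ] (S : κ → Finset ι)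
    {τ : κ → ℝ} (hτ : ∀ c, 0 ≤ τ c) (hS : ∀ i, ∃ c, i ∈ S c) :
    ∃ w : ι → ℝ, (∀ i, 0 ≤ w i) ∧ (∀ c, ∑ i ∈ S c, w i ≤ τ c) ∧
      ∀ i, ∃ c, i ∈ S c ∧ ∑ j ∈ S c, w j = τ c := by
  classical
  have := Fintype.ofFinite ι
  suffices h : ∀ T : Finset ι, ∃ w : ι → ℝ, (∀ i, 0 ≤ w i) ∧ (∀ c, ∑ i ∈ S c, w i ≤ τ c) ∧
      ∀ i ∈ T, ∃ c, i ∈ S c ∧ ∑ j ∈ S c, w j = τ c by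
    simpa only [Finset.mem_univ, true_imp_iff] using h Finset.univ
  intro T
  induction T using Finset.induction_on with
  | empty => exact ⟨0, by simp, by simpa using hτ, by simp⟩
  | insert i T _ ih =>
    obtain ⟨w, hw, hle, hsat⟩ := ih
    -- Raise the weight of `i` until the first set containing `i` becomes saturated.
    obtain ⟨c, hc, hmin⟩ := exists_min_image {c | i ∈ S c} (fun c => τ c - ∑ j ∈ S c, w j)
      (toFinite _) (hS i)
    rw [mem_ofPred_eq] at hc
    set δ := τ c - ∑ j ∈ S c, w j
    have hδ : 0 ≤ δ := sub_nonneg.2 (hle c)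
    have hsum (d : κ) :
        ∑ j ∈ S d, (w + Pi.single i δ : ι → ℝ) j = ∑ j ∈ S d, w j + if i ∈ S d then δ else 0 := by
      simp only [Pi.add_apply, Finset.sum_add_distrib, Finset.sum_pi_single']
    have hle' (d : κ) : ∑ j ∈ S d, (w + Pi.single i δ : ι → ℝ) j ≤ τ d := by
      rw [hsum]
      split_ifs with hd
      · linarith [hmin d hd]
      · simpa using hle d
    refine ⟨w + Pi.single i δ, add_nonneg (a := w) hw (Pi.single_nonneg.2 hδ), hle', ?_⟩
    rintro j hj
    obtain rfl | hj := Finset.mem_insert.1 hj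
    · exact ⟨c, hc, by rw [hsum, if_pos hc]; exact add_sub_cancel _ _⟩
    · obtain ⟨d, hjd, hd⟩ := hsat j hj
      refine ⟨d, hjd, (hle' d).antisymm ?_⟩
      rw [hsum, hd]
      split_ifs <;> linarith

/-- Max-flow min-cut on the tree of the increasingly fine partitions of `ι` into the fibres of
`f 0, f 1, …, f n`. -/
theorem exists_weight_sum_eq_cut {ι κ : Type*} [Fintype ι] [DecidableEq κ] {f : ℕ → ι → κ}
    (hf : ∀ {l m i j}, l ≤ m → f m i = f m j → f l i = f l j) {τ : ℕ → ℝ} (hτ : ∀ m, 0 ≤ τ m)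
    (n : ℕ) :
    ∃ w : ι → ℝ, (∀ i, 0 ≤ w i) ∧ (∀ m ≤ n, ∀ c, ∑ j with f m j = c, w j ≤ τ m) ∧
      ∃ m : ι → ℕ, (∀ i, m i ≤ n) ∧
        ∑ c ∈ Finset.univ.image fun i => (m i, f (m i) i), τ c.1 = ∑ i, w i := by
  classical
  obtain ⟨w, hw, hle, hsat⟩ := exists_saturated_weight
    (fun c : Fin (n + 1) × ι => {j | f c.1 j = f c.1 c.2}) (fun c => hτ c.1)
    (fun i => ⟨(0, i), Finset.mem_filter.2 ⟨Finset.mem_univ i, rfl⟩⟩)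
  have hsat' (i : ι) : ∃ m, m ≤ n ∧ ∑ j with f m j = f m i, w j = τ m := by
    obtain ⟨⟨m, k⟩, hik, hm⟩ := hsat i
    rw [← (Finset.mem_filter.1 hik).2] at hm
    exact ⟨m, Fin.is_le m, hm⟩
  -- The coarsest saturated fibres form a partition, which is the cut.
  set m : ι → ℕ := fun i => Nat.find (hsat' i)
  have hm (i : ι) : m i ≤ n ∧ ∑ j with f (m i) j = f (m i) i, w j = τ (m i) :=
    Nat.find_spec (hsat' i)
  have hm_eq {i j : ι} (h : f (m i) j = f (m i) i) : m j = m i := by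
    have hji : m j ≤ m i := Nat.find_min' (hsat' j) (by rw [h]; exact hm i)
    exact hji.antisymm (Nat.find_min' (hsat' i) (by rw [← hf hji h]; exact hm j))
  refine ⟨w, hw, fun l hl c => ?_, m, fun i => (hm i).1, ?_⟩
  · by_cases hc : ∃ i, f l i = c
    · obtain ⟨i, rfl⟩ := hc
      exact hle (⟨l, Nat.lt_succ_of_le hl⟩, i)
    · rw [Finset.filter_false_of_mem fun j _ hj => hc ⟨j, hj⟩, Finset.sum_empty]
      exact hτ l
  · rw [← Finset.sum_fiberwise_of_maps_to (g := fun i => (m i, f (m i) i)) (f := w)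
      fun i hi => Finset.mem_image_of_mem _ hi]
    refine Finset.sum_congr rfl fun c hc => ?_
    obtain ⟨i, -, rfl⟩ := Finset.mem_image.1 hc
    rw [← (hm i).2]
    refine Finset.sum_congr (Finset.filter_congr fun j _ => ?_) fun _ _ => rfl
    refine ⟨fun h => by rw [hm_eq h, h], fun h => ?_⟩
    obtain ⟨hmj, hfj⟩ := Prod.mk.inj h
    rwa [hmj] at hfj

/-- The index of the dyadic interval `[l / 2ᵐ, (l + 1) / 2ᵐ)` that contains `x`. -/
noncomputable def dyadicIndex (m : ℕ) (x : ℝ) : ℤ :=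
  ⌊x * 2 ^ m⌋

theorem dyadicIndex_eq_of_le {l m : ℕ} {x y : ℝ} (hlm : l ≤ m)
    (h : dyadicIndex m x = dyadicIndex m y) : dyadicIndex l x = dyadicIndex l y := by
  have hfloor (z : ℝ) : dyadicIndex l z = dyadicIndex m z / (2 ^ (m - l) : ℕ) := by
    rw [dyadicIndex, dyadicIndex, ← Int.floor_div_natCast]
    congr 1
    push_cast
    rw [eq_div_iff (by positivity), mul_assoc, ← pow_add, Nat.add_sub_cancel' hlm]
  rw [hfloor, hfloor, h]

theorem ediam_dyadicIndex_le (m : ℕ) (c : ℤ) :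
    Metric.ediam {x | dyadicIndex m x = c} ≤ ENNReal.ofReal (2 ^ m)⁻¹ := by
  refine Metric.ediam_le fun x hx y hy => ?_
  rw [edist_dist, Real.dist_eq]
  refine ENNReal.ofReal_le_ofReal ?_
  have h := Int.abs_sub_lt_one_of_floor_eq_floor (hx.trans hy.symm)
  rw [← sub_mul, abs_mul, abs_of_pos (by positivity : (0 : ℝ) < 2 ^ m)] at h
  rw [← one_div, le_div_iff₀ (by positivity)]
  exact h.le

theorem exists_finset_dyadicIndex {K : Set ℝ} (hK : Bornology.IsBounded K) (n : ℕ) :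
    ∃ Y : Finset ℝ, ↑Y ⊆ K ∧ ∀ x ∈ K, ∃ y ∈ Y, dyadicIndex n y = dyadicIndex n x := by
  classical
  obtain ⟨R, hR⟩ := hK.exists_norm_le
  have hfin : (dyadicIndex n '' K).Finite := by
    refine (Set.finite_Icc ⌊-R * 2 ^ n⌋ ⌊R * 2 ^ n⌋).subset ?_
    rintro _ ⟨x, hx, rfl⟩
    have := abs_le.1 (hR x hx)
    exact ⟨Int.floor_le_floor (by gcongr; exact this.1),
      Int.floor_le_floor (by gcongr; exact this.2)⟩
  obtain ⟨Y, hYK, hY⟩ := Finset.subset_set_image_iff.1 hfin.coe_toFinset.subset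
  refine ⟨Y, hYK, fun x hx => Finset.mem_image.1 ?_⟩
  rw [hY]
  exact hfin.mem_toFinset.2 ⟨x, hx, rfl⟩

theorem concentration_inv_two_pow_le {ι : Type*} [Fintype ι] {w y : ι → ℝ} (hw : ∀ i, 0 ≤ w i)
    {m : ℕ} {B : ℝ} (hB : ∀ c, ∑ i with dyadicIndex m (y i) = c, w i ≤ B) :
    concentration w y (2 ^ m)⁻¹ ≤ 2 * B := by
  classical
  refine concentration_le fun a => ?_
  have hindex {x : ℝ} (hx : x ∈ Ico a (a + (2 ^ m)⁻¹)) :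
      dyadicIndex m x = dyadicIndex m a ∨ dyadicIndex m x = dyadicIndex m a + 1 := by
    have h2m : (0 : ℝ) < 2 ^ m := by positivity
    have hle : dyadicIndex m a ≤ dyadicIndex m x := Int.floor_le_floor (by gcongr; exact hx.1)
    have hlt : dyadicIndex m x ≤ dyadicIndex m a + 1 := by
      refine (Int.floor_le_floor ?_).trans_eq (Int.floor_add_one _)
      have := mul_le_mul_of_nonneg_right hx.2.le h2m.le
      rwa [add_mul, inv_mul_cancel₀ h2m.ne'] at this
    lia
  calc ∑ i with y i ∈ Ico a (a + (2 ^ m)⁻¹), w i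
      ≤ ∑ i with dyadicIndex m (y i) = dyadicIndex m a ∨
          dyadicIndex m (y i) = dyadicIndex m a + 1, w i :=
        Finset.sum_le_sum_of_subset_of_nonneg
          (Finset.monotone_filter_right _ fun _ _ => hindex) fun i _ _ => hw i
    _ ≤ B + B := by
        rw [Finset.filter_or, Finset.sum_union
          (Finset.disjoint_filter.2 fun i _ h h' => by lia)]
        exact add_le_add (hB _) (hB _)
    _ = 2 * B := (two_mul B).symm

theorem exists_isFrostmanWeight {K : Set ℝ} (hbdd : Bornology.IsBounded K) {s : ℝ≥0} (hs : 0 < s)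
    (hK : (s : ℝ≥0∞) < dimH K) :
    ∃ C : ℝ, ∀ n : ℕ, ∃ (ι : Type) (_ : Fintype ι) (w y : ι → ℝ),
      IsFrostmanWeight C s n w y ∧ ∀ i, y i ∈ K := by
  classical
  obtain ⟨c, hc, hcontent⟩ := exists_le_sum_ediam_rpow hs hK
  refine ⟨2 / c, fun n => ?_⟩
  obtain ⟨Y, hYK, hY⟩ := exists_finset_dyadicIndex hbdd n
  obtain ⟨w, hw, hle, m, hmn, hcut⟩ := exists_weight_sum_eq_cut
    (f := fun m (y : Y) => dyadicIndex m (y : ℝ)) dyadicIndex_eq_of_le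
    (τ := fun m => ((2 : ℝ) ^ m)⁻¹ ^ (s : ℝ)) (fun m => by positivity) n
  set T := Finset.univ.image fun i => (m i, dyadicIndex (m i) (i : ℝ))
  have hcover : K ⊆ ⋃ u : T, {x | dyadicIndex u.1.1 x = u.1.2} := fun x hx => by
    obtain ⟨y, hy, hyx⟩ := hY x hx
    exact mem_iUnion.2 ⟨⟨_, Finset.mem_image_of_mem _ (Finset.mem_univ ⟨y, hy⟩)⟩,
      dyadicIndex_eq_of_le (hmn _) hyx.symm⟩
  have hmass : (c : ℝ) ≤ ∑ i, w i := by
    rw [← ENNReal.ofReal_le_ofReal_iff (Finset.sum_nonneg fun i _ => hw i),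
      ENNReal.ofReal_coe_nnreal, ← hcut, ENNReal.ofReal_sum_of_nonneg fun u _ => by positivity,
      ← Finset.sum_coe_sort T]
    refine (hcontent T _ hcover).trans (Finset.sum_le_sum fun u _ => ?_)
    rw [← ENNReal.ofReal_rpow_of_nonneg (by positivity) (by positivity)]
    gcongr
    exact ediam_dyadicIndex_le _ _
  have hpos : 0 < ∑ i, w i := hmass.trans_lt' (by exact_mod_cast hc)
  have hnonneg (i : Y) : 0 ≤ w i / ∑ i, w i := div_nonneg (hw i) hpos.le
  refine ⟨Y, inferInstance, fun i => w i / ∑ i, w i, (↑), ⟨hnonneg, ?_, fun m hm => ?_⟩,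
    fun i => hYK i.2⟩
  · rw [← Finset.sum_div, div_self hpos.ne']
  · refine (concentration_inv_two_pow_le hnonneg (B := ((2 : ℝ) ^ m)⁻¹ ^ (s : ℝ) / c)
      fun l => ?_).trans_eq (by ring)
    rw [← Finset.sum_div]
    have := hle m hm l
    gcongr

end Frostman

section Falconer

theorem le_measure_add_smul_of_tendsto {A B : Set ℝ} (hA : IsCompact A) (hB : IsCompact B)
    {μ : Measure ℝ} [IsFiniteMeasureOnCompacts μ] {c : ℝ≥0∞} {x ε : ℕ → ℝ} {z : ℝ}
    (hx : Tendsto x atTop (𝓝 z)) (hε : Tendsto ε atTop (𝓝 0))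
    (hc : ∀ n, c ≤ μ (Metric.cthickening (ε n) (A + x n • B))) : c ≤ μ (A + z • B) := by
  obtain ⟨R, hR⟩ := hB.isBounded.exists_norm_le
  have hR' (f) (hf : f ∈ B) : ‖f‖ ≤ |R| := (hR f hf).trans (le_abs_self R)
  have hsub (n : ℕ) : A + x n • B ⊆ Metric.cthickening (|x n - z| * |R|) (A + z • B) := by
    rintro _ ⟨e, he, _, ⟨f, hf, rfl⟩, rfl⟩
    refine Metric.mem_cthickening_of_dist_le _ (e + z • f) _ _
      (add_mem_add he (smul_mem_smul_set hf)) ?_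
    rw [dist_add_left, dist_eq_norm, ← sub_smul, norm_smul, Real.norm_eq_abs]
    gcongr
    exact hR' f hf
  have hthick (n : ℕ) : c ≤ μ (Metric.cthickening (|ε n| + |x n - z| * |R|) (A + z • B)) := by
    refine (hc n).trans (measure_mono ?_)
    calc Metric.cthickening (ε n) (A + x n • B)
        ⊆ Metric.cthickening |ε n| (A + x n • B) := Metric.cthickening_mono (le_abs_self _) _
      _ ⊆ Metric.cthickening |ε n| (Metric.cthickening (|x n - z| * |R|) (A + z • B)) :=
        Metric.cthickening_subset_of_subset _ (hsub n)
      _ ⊆ Metric.cthickening (|ε n| + |x n - z| * |R|) (A + z • B) :=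
        Metric.cthickening_cthickening_subset (abs_nonneg _) (by positivity) _
  have hlim : Tendsto (fun n => |ε n| + |x n - z| * |R|) atTop (𝓝 0) := by
    simpa using hε.abs.add ((hx.sub_const z).abs.mul_const |R|)
  exact ge_of_tendsto' ((tendsto_measure_cthickening_of_isCompact
    (hA.add (hB.smul z))).comp hlim) hthick

/-- A form of Falconer's theorem on exceptional projections. -/
theorem exists_volume_add_smul_pos {A B X : Set ℝ} (hA : IsCompact A) (hB : IsCompact B)
    (hX : IsCompact X) (hB1 : ∀ f ∈ B, |f| ≤ 1) (hX1 : X ⊆ Icc 0 1) {s t u : ℝ≥0}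
    (hs : 0 < s) (ht : 0 < t) (hu : 0 < u) (hsA : (s : ℝ≥0∞) < dimH A)
    (htB : (t : ℝ≥0∞) < dimH B) (huX : (u : ℝ≥0∞) < dimH X) (hstu : 2 < s + t + u) :
    ∃ x ∈ X, 0 < volume (A + x • B) := by
  obtain ⟨C₁, h₁⟩ := exists_isFrostmanWeight hA.isBounded hs hsA
  obtain ⟨C₂, h₂⟩ := exists_isFrostmanWeight hB.isBounded ht htB
  obtain ⟨C₃, h₃⟩ := exists_isFrostmanWeight hX.isBounded hu huX
  set c : ℝ≥0∞ := (ENNReal.ofReal (4 * energyBound (C₁ * C₂ * C₃) (s + t + u - 2)))⁻¹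
  have hdiscrete (n : ℕ) :
      ∃ x ∈ X, c ≤ volume (Metric.cthickening (2 ^ n)⁻¹ (A + x • B)) := by
    obtain ⟨ι, _, w, y, hw, hyA⟩ := h₁ n
    obtain ⟨κ, _, w', v, hw', hvB⟩ := h₂ n
    obtain ⟨τ, _, w'', x, hw'', hxX⟩ := h₃ n
    obtain ⟨k, hk⟩ := exists_le_volume_cthickening hw hw' hw'' (fun j => hB1 _ (hvB j))
      (fun k => hX1 (hxX k)) (by exact_mod_cast hstu)
    refine ⟨x k, hxX k, hk.trans (measure_mono (Metric.cthickening_subset_of_subset _ ?_))⟩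
    rintro _ ⟨p, rfl⟩
    exact add_mem_add (hyA _) (smul_mem_smul_set (hvB _))
  choose x hxX hx using hdiscrete
  obtain ⟨z, hz, φ, hφ, hlim⟩ := hX.tendsto_subseq hxX
  have hε : Tendsto (fun n => ((2 : ℝ) ^ φ n)⁻¹) atTop (𝓝 0) :=
    (tendsto_pow_atTop_atTop_of_one_lt one_lt_two).inv_tendsto_atTop.comp hφ.tendsto_atTop
  have hc : 0 < c := ENNReal.inv_pos.2 ENNReal.ofReal_ne_top
  exact ⟨z, hz, hc.trans_le
    (le_measure_add_smul_of_tendsto hA hB hlim hε fun n => hx (φ n))⟩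

end Falconer

section Steinhaus

/-- Since `∫ μ (A ∩ (c - B)) dμ c = μ A * μ B`, some `A ∩ (c - B)` has positive measure, and its
difference set is contained in `A + B - c`. -/
theorem nonempty_interior_add_of_measure_pos {G : Type*} [AddCommGroup G] [TopologicalSpace G]
    [IsTopologicalAddGroup G] [SecondCountableTopology G] [LocallyCompactSpace G]
    [MeasurableSpace G] [BorelSpace G] (μ : Measure G) [μ.IsAddHaarMeasure] {A B : Set G}
    (hA : MeasurableSet A) (hB : MeasurableSet B) (hA0 : 0 < μ A) (hB0 : 0 < μ B) :
    (interior (A + B)).Nonempty := by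
  obtain ⟨c, hc⟩ : ∃ c, 0 < μ (A ∩ (c - ·) ⁻¹' B) := by
    by_contra! hnull
    have hshear := measurePreserving_prod_sub_swap μ μ
    have hprod : (μ.prod μ) ((fun p : G × G => (p.2, p.1 - p.2)) ⁻¹' A ×ˢ B) = 0 :=
      (Measure.measure_prod_null (hshear.measurable (hA.prod hB))).2
        (.of_forall fun c => nonpos_iff_eq_zero.1 (hnull c))
    rw [hshear.measure_preimage (hA.prod hB).nullMeasurableSet, Measure.prod_prod,
      mul_eq_zero] at hprod
    exact hprod.elim hA0.ne' hB0.ne'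
  have hmeas : MeasurableSet (A ∩ (c - ·) ⁻¹' B) := hA.inter (measurable_const_sub c hB)
  refine ⟨c, mem_interior_iff_mem_nhds.2 ?_⟩
  have hsub := Measure.sub_mem_nhds_zero_of_addHaar_pos μ _ hmeas hc
  have hlim : Tendsto (· - c) (𝓝 c) (𝓝 0) :=
    (continuous_sub_right c).tendsto' c 0 (sub_self c)
  filter_upwards [hlim hsub] with t ht
  obtain ⟨a, ha, b, hb, hab⟩ := ht
  refine ⟨a, ha.1, c - b, hb.2, ?_⟩
  calc a + (c - b) = c + (a - b) := by abel
    _ = c + (t - c) := congrArg (c + ·) hab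
    _ = t := add_sub_cancel c t

end Steinhaus

section DyadicCone

/-- A subset of `[0, 1)` closed under halving and under those sums that stay below `1`. These are
the closure properties of an Erdős semigroup that make it a basis of order two. -/
structure IsDyadicCone (A : Set ℝ) : Prop where
  subset_Ico : A ⊆ Ico 0 1
  half_mem {x : ℝ} (hx : x ∈ A) : x / 2 ∈ A
  add_mem {x y : ℝ} (hx : x ∈ A) (hy : y ∈ A) (hxy : x + y < 1) : x + y ∈ A

namespace IsDyadicCone

variable {A : Set ℝ} (hA : IsDyadicCone A)

include hA

theorem div_two_pow_mem {x : ℝ} (hx : x ∈ A) (N : ℕ) : x / 2 ^ N ∈ A := by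
  induction N with
  | zero => simpa using hx
  | succ N ih =>
    rw [pow_succ, ← div_div]
    exact hA.half_mem ih

theorem mul_mem {x : ℝ} (hx : x ∈ A) {m : ℕ} (hm : 0 < m) (hmx : m * x < 1) : m * x ∈ A := by
  induction m, hm using Nat.le_induction with
  | base => simpa using hx
  | succ m _ ih =>
    rw [Nat.cast_succ, add_one_mul] at hmx ⊢
    exact hA.add_mem (ih (by linarith [(hA.subset_Ico hx).1])) hx hmx

theorem mul_div_two_pow_add_mem {x y : ℝ} (hx : x ∈ A) (hy : y ∈ A) {m N : ℕ} (hm : 0 < m)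
    (hmN : 2 * m ≤ 2 ^ N) : m * (x / 2 ^ N) + m * (y / 2 ^ N) ∈ A := by
  have hlt {z : ℝ} (hz : z ∈ A) : m * (z / 2 ^ N) < 1 / 2 := by
    have hm0 : (0 : ℝ) < m := by exact_mod_cast hm
    have hmN' : 2 * (m : ℝ) ≤ 2 ^ N := by exact_mod_cast hmN
    rw [mul_div_assoc', div_lt_iff₀ (by positivity)]
    nlinarith [(hA.subset_Ico hz).2]
  have hmem {z : ℝ} (hz : z ∈ A) : m * (z / 2 ^ N) ∈ A :=
    hA.mul_mem (hA.div_two_pow_mem hz N) hm (by linarith [hlt hz])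
  exact hA.add_mem (hmem hx) (hmem hy) (by linarith [hlt hx, hlt hy])

end IsDyadicCone

theorem eventually_exists_nat_mul_le_and_le {p q : ℝ} (hp : 0 < p) (hpq : p < q) :
    ∀ᶠ y in atTop, ∃ m : ℕ, m * p ≤ y ∧ y ≤ m * q := by
  have hqp : 0 < q - p := sub_pos.2 hpq
  filter_upwards [eventually_ge_atTop ((p / (q - p) + 1) * p)] with y hy
  have hy0 : 0 ≤ y / p := div_nonneg (hy.trans' (by positivity)) hp.le
  have hfloor := Nat.floor_le hy0
  have hlt := Nat.lt_floor_add_one (y / p)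
  refine ⟨⌊y / p⌋₊, (le_div_iff₀ hp).1 hfloor, ?_⟩
  have hm : p ≤ ⌊y / p⌋₊ * (q - p) := by
    rw [← le_div_iff₀ hp] at hy
    rw [← div_le_iff₀ hqp]
    linarith
  rw [div_lt_iff₀ hp] at hlt
  linarith

/-- Writing `t = (m / 2ᴺ) u` with `u ∈ [p, q]` and `m / 2ᴺ ≤ 1 / 2`, the multiplier carries
`A + A` into `A`. -/
theorem IsDyadicCone.isBasisOfOrderTwo {A : Set ℝ} (hA : IsDyadicCone A) {x p q : ℝ} (hx : x ∈ A)
    (hp : 0 < p) (hpq : p < q) (hsub : Icc p q ⊆ (A + x • A) + (A + x • A)) :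
    IsBasisOfOrderTwo A (Ioc 0 (p / 2)) := by
  refine ⟨x, hx, fun t ht => ?_⟩
  have hlim : Tendsto (fun N : ℕ => 2 ^ N * t) atTop atTop :=
    (tendsto_pow_atTop_atTop_of_one_lt one_lt_two).atTop_mul_const ht.1
  obtain ⟨N, m, hmp, hmq⟩ := (hlim.eventually (eventually_exists_nat_mul_le_and_le hp hpq)).exists
  have hpow : (0 : ℝ) < 2 ^ N := by positivity
  have hm : 0 < (m : ℝ) := by
    have := (mul_pos hpow ht.1).trans_le hmq
    exact pos_of_mul_pos_left this (hp.trans hpq).le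
  have hmN : 2 * (m : ℝ) ≤ 2 ^ N := by
    refine le_of_mul_le_mul_right ?_ hp
    nlinarith [ht.2]
  obtain ⟨_, ⟨e, he, _, ⟨f, hf, rfl⟩, rfl⟩, _, ⟨e', he', _, ⟨f', hf', rfl⟩, rfl⟩, hu⟩ :=
    hsub (show 2 ^ N * t / m ∈ Icc p q from
      ⟨(le_div_iff₀' hm).2 hmp, (div_le_iff₀' hm).2 hmq⟩)
  have hmem {y z : ℝ} (hy : y ∈ A) (hz : z ∈ A) : m * (y / 2 ^ N) + m * (z / 2 ^ N) ∈ A :=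
    hA.mul_div_two_pow_add_mem hy hz (by exact_mod_cast hm) (by exact_mod_cast hmN)
  refine ⟨_, hmem he he', _, ⟨_, hmem hf hf', rfl⟩, ?_⟩
  simp only [smul_eq_mul] at hu ⊢
  field_simp at hu ⊢
  linarith

end DyadicCone

theorem exists_Icc_subset_add_of_volume_pos {P : Set ℝ} (hP : MeasurableSet P)
    (hP0 : 0 < volume P) (hnonneg : P ⊆ Ici 0) : ∃ p q, 0 < p ∧ p < q ∧ Icc p q ⊆ P + P := by
  obtain ⟨p, hp⟩ := nonempty_interior_add_of_measure_pos volume hP hP hP0 hP0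
  have hsub : P + P ⊆ Ici 0 := by
    rintro _ ⟨u, hu, v, hv, rfl⟩
    exact mem_Ici.2 (add_nonneg (hnonneg hu :) (hnonneg hv :))
  obtain ⟨q, hpq, hIcc⟩ := mem_nhdsGE_iff_exists_Icc_subset.1
    (mem_nhdsWithin_of_mem_nhds (mem_interior_iff_mem_nhds.1 hp))
  exact ⟨p, q, by simpa using interior_mono hsub hp, hpq, hIcc⟩

theorem exists_isCompact_subset_lt_dimH {X : Type*} [EMetricSpace X] {A : Set X}
    (hA : IsSigmaCompact A) {d : ℝ≥0∞} (hd : d < dimH A) : ∃ K ⊆ A, IsCompact K ∧ d < dimH K := by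
  obtain ⟨K, hK, rfl⟩ := hA
  rw [dimH_iUnion] at hd
  obtain ⟨i, hi⟩ := lt_iSup_iff.1 hd
  exact ⟨K i, subset_iUnion K i, hK i, hi⟩

section ErdosSemigroup

variable {E : Set UnitAddCircle}

theorem isBinarySubsequence_half {x : ℝ} (hx : x ∈ Ico (0 : ℝ) 1) :
    IsBinarySubsequence (x / 2) x := by
  refine ⟨1, one_pos, fun j hj => ?_, fun i hi => ?_⟩
  · obtain rfl : j = 0 := Nat.lt_one_iff.1 hj
    have hfloor : ⌊x⌋₊ = 0 := Nat.floor_eq_zero.2 hx.2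
    simp [Real.digits, hfloor]
  · rw [← hi]
    simp only [Real.digits]
    congr 2
    push_cast
    ring

theorem IsErdosSemigroup.isDyadicCone (hE : IsErdosSemigroup E) :
    IsDyadicCone (circleToUnit E) := by
  obtain ⟨F, rfl, -, -, ⟨W, hW⟩, hsub⟩ := hE
  refine ⟨fun x hx => hx.1, fun {x} hx => ?_, fun {x y} hx hy hxy => ?_⟩
  · obtain ⟨i, hi⟩ := mem_iUnion.1 hx.2
    have hhalf : x / 2 ∈ Ico (0 : ℝ) 1 := ⟨by linarith [hx.1.1], by linarith [hx.1.1, hx.1.2]⟩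
    have hmem := hsub i x ⟨hx.1, hi⟩ _ hhalf (isBinarySubsequence_half hx.1)
    exact ⟨hhalf, mem_iUnion.2 ⟨i, hmem.2⟩⟩
  · obtain ⟨i, hi⟩ := mem_iUnion.1 hx.2
    obtain ⟨j, hj⟩ := mem_iUnion.1 hy.2
    exact ⟨⟨add_nonneg hx.1.1 hy.1.1, hxy⟩,
      mem_iUnion.2 ⟨W i j, hW i j (add_mem_add hi hj)⟩⟩

theorem IsErdosSemigroup.isSigmaCompact (hE : IsErdosSemigroup E) :
    IsSigmaCompact (circleToUnit E) := by
  obtain ⟨F, rfl, hF, -⟩ := hE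
  have hunion : circleToUnit (⋃ i, F i) =
      ⋃ i, Ico 0 1 ∩ (fun x : ℝ => (x : UnitAddCircle)) ⁻¹' F i := by
    rw [← inter_iUnion, ← preimage_iUnion]
    rfl
  rw [hunion]
  refine isSigmaCompact_iUnion _ fun i => isSigmaCompact_iff_sigmaCompactSpace.2 ?_
  have : LocallyCompactSpace ↥(Ico 0 1 ∩ (fun x : ℝ => (x : UnitAddCircle)) ⁻¹' F i) :=
    (isLocallyClosed_Ico.inter
      ((hF i).preimage (AddCircle.continuous_mk' 1)).isLocallyClosed).locallyCompactSpace
  infer_instance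

end ErdosSemigroup

theorem theorem3p6_general {A : Set ℝ} (hA : IsDyadicCone A) (hσ : IsSigmaCompact A)
    (hdim : 2 / 3 < dimH A) : ∃ b : ℝ, 0 < b ∧ IsBasisOfOrderTwo A (Ioc 0 b) := by
  obtain ⟨K, hKA, hK, hKdim⟩ := exists_isCompact_subset_lt_dimH hσ hdim
  obtain ⟨s, hs, hsK⟩ := ENNReal.lt_iff_exists_nnreal_btwn.1 hKdim
  have hK01 : K ⊆ Icc 0 1 := (hKA.trans hA.subset_Ico).trans Ico_subset_Icc_self
  have hsum : 2 < s + s + s := by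
    rw [ENNReal.div_lt_iff (by simp) (by simp)] at hs
    have : 2 < s * 3 := by exact_mod_cast hs
    linarith
  have hs0 : 0 < s := pos_of_ne_zero fun h => by norm_num [h] at hsum
  obtain ⟨x, hxK, hpos⟩ := exists_volume_add_smul_pos hK hK hK
    (fun f hf => abs_le.2 ⟨by linarith [(hK01 hf).1], (hK01 hf).2⟩)
    hK01 hs0 hs0 hs0 hsK hsK hsK hsum
  have hnonneg : K + x • K ⊆ Ici 0 := by
    rintro _ ⟨e, he, _, ⟨f, hf, rfl⟩, rfl⟩
    exact add_nonneg (hK01 he).1 (mul_nonneg (hK01 hxK).1 (hK01 hf).1)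
  obtain ⟨p, q, hp, hpq, hsub⟩ := exists_Icc_subset_add_of_volume_pos
    (hK.add (hK.smul x)).measurableSet hpos hnonneg
  have hmono : K + x • K ⊆ A + x • A := add_subset_add hKA (smul_set_mono hKA)
  exact ⟨p / 2, half_pos hp,
    hA.isBasisOfOrderTwo (hKA hxK) hp hpq (hsub.trans (add_subset_add hmono hmono))⟩

theorem theorem3p6 (E : Set UnitAddCircle) (hE : IsErdosSemigroup E)
    (hdim : dimH (circleToUnit E) = 1) :
    ∃ b : ℝ, 0 < b ∧ IsBasisOfOrderTwo (circleToUnit E) (Set.Ioc 0 b) :=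
  theorem3p6_general hE.isDyadicCone hE.isSigmaCompact (by
    rw [hdim, ENNReal.div_lt_iff (by simp) (by simp)]
    norm_num)
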